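/- Let $q\in(0,1)$. Let $U_q\mathfrak{sl}_2$ be the unital associative $\mathbb C$-algebra with generators $K,K^{-1},E,F$ and relations $$KK^{-1}=K^{-1}K=1,\quad K^{\pm1}E=q^{\pm2}EK^{\pm1},\quad K^{\pm1}F=q^{\mp2}FK^{\pm1},\quad EF-FE=\frac{K-K^{-1}}{q-q^{-1}},$$ a Hopf algebra with $\Delta(K^{\pm1})=K^{\pm1}\otimes K^{\pm1}$, $\Delta(E)=E\otimes1+K\otimes E$, $\Delta(F)=F\otimes K^{-1}+1\otimes F$ and counit $\varepsilon(E)=\varepsilon(F)=0$, $\varepsilon(K^{\pm1})=1$; the field $\mathbb C$ is regarded as the trivial $U_q\mathfrak{sl}_2$-module, on which $a$ acts as multiplication by $\varepsilon(a)$. Let $\mathrm{Pol}(\mathbb C)_q$ be the algebra generated by $z,z^*$ with the relation $z^*z=q^2zz^*+1-q^2$; its monomials $z^jz^{*k}$, $j,k\ge 0$, form a basis. $U_q\mathfrak{sl}_2$ acts on it so that $a\cdot1=\varepsilon(a)1$, the multiplication $\mathrm{Pol}(\mathbb C)_q\otimes\mathrm{Pol}(\mathbb C)_q\to\mathrm{Pol}(\mathbb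 C)_q$ is a morphism of modules, and $$K^{\pm1}z=q^{\pm2}z,\quad Fz=q^{1/2},\quad Ez=-q^{1/2}z^2,\qquad K^{\pm1}z^*=q^{\mp2}z^*,\quad Ez^*=q^{-3/2},\quad Fz^*=-q^{5/2}z^{*2}.$$ Let $D(U)_q'$ be the space of formal series $\sum_{j,k\ge0}a_{jk}z^jz^{*k}$, $a_{jk}\in\mathbb C$, with the topology of coefficientwise convergence; the $\mathrm{Pol}(\mathbb C)_q$-bimodule structure and the $U_q\mathfrak{sl}_2$-action are extended to it by continuity. Let $$D(U)_q=\{f\in D(U)_q' \mid z^{*N}f=fz^N=0\ \text{for some } N\in\mathbb N\},$$ a $U_q\mathfrak{sl}_2$-submodule of $D(U)_q'$, and let $$f_0=\sum_{k\ge0}\frac{(-1)^kq^{k(k-1)}}{\prod_{i=1}^k(1-q^{2i})}\,z^kz^{*k}\in D(U)_q,$$ which is the element with $z^*f_0=f_0z=0$ whose coefficient at $1=z^0z^{*0}$ is $1$. Then $f_0$ generates the $U_q\mathfrak{sl}_2$-module $D(U)_q$, and the invariant integral on $D(U)_q$ is unique up to a scalar multiple: $$\dim_{\mathbb C}\mathrm{Hom}_{U_q\mathfrak{sl}_2}(D(U)_q,\mathbb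 C)\le1 .$$ -/

import Mathlib

noncomputable section

namespace QuantumDisc

/-! ## The quantum universal enveloping algebra

The deformation parameter is a number `q` of the open interval `(0, 1)`. -/

/-- The generators of the quantum universal enveloping algebra of `sl₂`. -/
inductive UqGen
  | E
  | F
  | K
  | Kinv

open UqGen FreeAlgebra

/-- The defining relations of the quantum universal enveloping algebra of `sl₂`. -/
inductive UqRel (q : Set.Ioo (0 : ℝ) 1) : FreeAlgebra ℂ UqGen → FreeAlgebra ℂ UqGen → Prop
  | K_Kinv : UqRel q (ι ℂ K * ι ℂ Kinv) 1
  | Kinv_K : UqRel q (ι ℂ Kinv * ι ℂ K) 1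
  | K_E : UqRel q (ι ℂ K * ι ℂ E) (((q : ℝ) : ℂ) ^ 2 • (ι ℂ E * ι ℂ K))
  | Kinv_E : UqRel q (ι ℂ Kinv * ι ℂ E) ((((q : ℝ) : ℂ) ^ 2)⁻¹ • (ι ℂ E * ι ℂ Kinv))
  | K_F : UqRel q (ι ℂ K * ι ℂ F) ((((q : ℝ) : ℂ) ^ 2)⁻¹ • (ι ℂ F * ι ℂ K))
  | Kinv_F : UqRel q (ι ℂ Kinv * ι ℂ F) (((q : ℝ) : ℂ) ^ 2 • (ι ℂ F * ι ℂ Kinv))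
  | E_F : UqRel q (ι ℂ E * ι ℂ F - ι ℂ F * ι ℂ E)
      ((((q : ℝ) : ℂ) - ((q : ℝ) : ℂ)⁻¹)⁻¹ • (ι ℂ K - ι ℂ Kinv))

/-- The unital associative complex algebra `U_q sl₂`. -/
abbrev Uq (q : Set.Ioo (0 : ℝ) 1) : Type := RingQuot (UqRel q)

/-- The image of a generator in `U_q sl₂`. -/
def Uq.gen (q : Set.Ioo (0 : ℝ) 1) (g : UqGen) : Uq q :=
  RingQuot.mkAlgHom ℂ (UqRel q) (ι ℂ g)

/-- The values of the counit on the generators: `ε(E) = ε(F) = 0`, `ε(K) = ε(K⁻¹) = 1`. -/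
def counitGen : UqGen → ℂ
  | E => 0
  | F => 0
  | K => 1
  | Kinv => 1

theorem counit_rel (q : Set.Ioo (0 : ℝ) 1) ⦃x y : FreeAlgebra ℂ UqGen⦄ (h : UqRel q x y) :
    FreeAlgebra.lift ℂ counitGen x = FreeAlgebra.lift ℂ counitGen y := by
  cases h <;> simp [counitGen]

/-- The counit `ε : U_q sl₂ → ℂ`. -/
def counit (q : Set.Ioo (0 : ℝ) 1) : Uq q →ₐ[ℂ] ℂ :=
  RingQuot.liftAlgHom ℂ ⟨FreeAlgebra.lift ℂ counitGen, counit_rel q⟩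

/-- The trivial `U_q sl₂`-module: the vector space `ℂ`, on which `a` acts as the
multiplication by `ε(a)`. -/
def TrivialModule (_ : Set.Ioo (0 : ℝ) 1) : Type := ℂ

instance (q : Set.Ioo (0 : ℝ) 1) : AddCommGroup (TrivialModule q) :=
  inferInstanceAs (AddCommGroup ℂ)

instance (q : Set.Ioo (0 : ℝ) 1) : Module ℂ (TrivialModule q) :=
  inferInstanceAs (Module ℂ ℂ)

instance (q : Set.Ioo (0 : ℝ) 1) : Module (Uq q) (TrivialModule q) :=
  Module.compHom ℂ (counit q).toRingHom

instance (q : Set.Ioo (0 : ℝ) 1) : IsScalarTower ℂ (Uq q) (TrivialModule q) where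
  smul_assoc c a x := by
    change counit q (c • a) * (show ℂ from x) = c * (counit q a * (show ℂ from x))
    rw [map_smul, smul_eq_mul, mul_assoc]

instance (q : Set.Ioo (0 : ℝ) 1) : SMulCommClass (Uq q) ℂ (TrivialModule q) where
  smul_comm a c x := by
    change counit q a * (c * (show ℂ from x)) = c * (counit q a * (show ℂ from x))
    ring

/-! ## Distributions in the quantum disc -/

/-- The space of distributions `D(U)_q'` in the quantum disc: the formal series
`f = ∑ f j k • z ^ j * zstar ^ k`, given by their coefficients. The finite sums of this form
are the polynomials `Pol(ℂ)_q`, an algebra with the commutation relation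
`zstar * z = q ^ 2 * z * zstar + 1 - q ^ 2`. -/
def Distribution (_ : Set.Ioo (0 : ℝ) 1) : Type := ℕ → ℕ → ℂ

instance (q : Set.Ioo (0 : ℝ) 1) : AddCommGroup (Distribution q) :=
  inferInstanceAs (AddCommGroup (ℕ → ℕ → ℂ))

instance (q : Set.Ioo (0 : ℝ) 1) : Module ℂ (Distribution q) :=
  inferInstanceAs (Module ℂ (ℕ → ℕ → ℂ))

variable (q : Set.Ioo (0 : ℝ) 1)

/-- The complex number `q`. -/
def qc : ℂ := ((q : ℝ) : ℂ)

/-- The complex number `q ^ (1/2)`. -/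
def sq : ℂ := ((Real.sqrt (q : ℝ) : ℝ) : ℂ)

theorem sq_ne : sq q ≠ 0 := by
  have := Real.sqrt_pos.2 q.2.1
  simpa [sq] using this.ne'

theorem qc_eq : qc q = sq q ^ 2 := by
  have := Real.sq_sqrt q.2.1.le
  rw [qc, sq, ← Complex.ofReal_pow, this]

theorem qc_ne : qc q ≠ 0 := by
  simpa [qc] using q.2.1.ne'

theorem one_sub_ne : 1 - qc q ^ 2 ≠ 0 := by
  have h : (1 : ℝ) - (q : ℝ) ^ 2 ≠ 0 := by nlinarith [q.2.1, q.2.2]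
  rw [qc]
  exact_mod_cast h

variable {q}

@[ext] theorem Distribution.ext {f g : Distribution q} (h : ∀ a b, f a b = g a b) : f = g :=
  funext fun a => funext fun b => h a b

@[simp] theorem Distribution.add_coeff (f g : Distribution q) (a b : ℕ) :
    (f + g) a b = f a b + g a b := rfl

@[simp] theorem Distribution.sub_coeff (f g : Distribution q) (a b : ℕ) :
    (f - g) a b = f a b - g a b := rfl

@[simp] theorem Distribution.smul_coeff (c : ℂ) (f : Distribution q) (a b : ℕ) :
    (c • f) a b = c * f a b := rfl

@[simp] theorem Distribution.zero_coeff (a b : ℕ) : (0 : Distribution q) a b = 0 := rfl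

variable (q)

/-- The polynomial `1`. -/
def one : Distribution q
  | 0, 0 => 1
  | _, _ => 0

/-- The left multiplication by `z`. -/
def leftZFun (f : Distribution q) : Distribution q
  | 0, _ => 0
  | a + 1, b => f a b

/-- `leftZFun` as a linear operator. -/
def leftZ : Distribution q →ₗ[ℂ] Distribution q where
  toFun := leftZFun q
  map_add' f g := by ext (_ | a) b <;> simp [leftZFun]
  map_smul' c f := by ext (_ | a) b <;> simp [leftZFun]

/-- The left multiplication by `zstar`, according to
`zstar * z ^ j = q ^ (2 * j) * z ^ j * zstar + (1 - q ^ (2 * j)) * z ^ (j - 1)`. -/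
def leftZstarFun (f : Distribution q) : Distribution q
  | a, 0 => (1 - (qc q ^ 2) ^ (a + 1)) * f (a + 1) 0
  | a, b + 1 => (qc q ^ 2) ^ a * f a b + (1 - (qc q ^ 2) ^ (a + 1)) * f (a + 1) (b + 1)

/-- `leftZstarFun` as a linear operator. -/
def leftZstar : Distribution q →ₗ[ℂ] Distribution q where
  toFun := leftZstarFun q
  map_add' f g := by ext a (_ | b) <;> simp [leftZstarFun] <;> ring
  map_smul' c f := by ext a (_ | b) <;> simp [leftZstarFun] <;> ring

/-- The right multiplication by `z`, according to
`zstar ^ k * z = q ^ (2 * k) * z * zstar ^ k + (1 - q ^ (2 * k)) * zstar ^ (k - 1)`. -/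
def rightZFun (f : Distribution q) : Distribution q
  | 0, b => (1 - (qc q ^ 2) ^ (b + 1)) * f 0 (b + 1)
  | a + 1, b => (qc q ^ 2) ^ b * f a b + (1 - (qc q ^ 2) ^ (b + 1)) * f (a + 1) (b + 1)

/-- `rightZFun` as a linear operator. -/
def rightZ : Distribution q →ₗ[ℂ] Distribution q where
  toFun := rightZFun q
  map_add' f g := by ext (_ | a) b <;> simp [rightZFun] <;> ring
  map_smul' c f := by ext (_ | a) b <;> simp [rightZFun] <;> ring

/-! ### The action of `U_q sl₂`

The action on `Pol(ℂ)_q` is determined by the covariance of this algebra, that is by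
`K (f * g) = K f * K g`, `E (f * g) = E f * g + K f * E g`,
`F (f * g) = F f * K⁻¹ g + f * F g`, `K 1 = 1`, `E 1 = F 1 = 0`, and by
`K z = q ^ 2 * z`, `E z = - q ^ (1/2) * z ^ 2`, `F z = q ^ (1/2)`,
`K zstar = q ^ (-2) * zstar`, `E zstar = q ^ (-3/2)`, `F zstar = - q ^ (5/2) * zstar ^ 2`.
The operators below are its (unique) continuous extensions to the formal series with the
topology of coefficientwise convergence; on the monomials they are given by

* `K (z ^ j * zstar ^ k) = q ^ (2 * j - 2 * k) * z ^ j * zstar ^ k`,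
* `E (z ^ j * zstar ^ k) =
    - q ^ (1/2) * (1 - q ^ (2 * j)) / (1 - q ^ 2) * z ^ (j + 1) * zstar ^ k
    + q ^ (2 * j) * q ^ (-3/2) * (1 - q ^ (-2 * k)) / (1 - q ^ (-2)) * z ^ j * zstar ^ (k - 1)`,
* `F (z ^ j * zstar ^ k) =
    q ^ (1/2) * (1 - q ^ (-2 * j)) / (1 - q ^ (-2)) * q ^ (2 * k) * z ^ (j - 1) * zstar ^ k
    - q ^ (5/2) * (1 - q ^ (2 * k)) / (1 - q ^ 2) * z ^ j * zstar ^ (k + 1)`. -/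

/-- The action of `K`. -/
def actKFun (f : Distribution q) : Distribution q :=
  fun a b => (qc q ^ 2) ^ a * ((qc q ^ 2)⁻¹) ^ b * f a b

/-- `actKFun` as a linear operator. -/
def actK : Distribution q →ₗ[ℂ] Distribution q where
  toFun := actKFun q
  map_add' f g := by ext a b; simp [actKFun]; ring
  map_smul' c f := by ext a b; simp [actKFun]; ring

/-- The action of `K⁻¹`. -/
def actKinvFun (f : Distribution q) : Distribution q :=
  fun a b => ((qc q ^ 2)⁻¹) ^ a * (qc q ^ 2) ^ b * f a b

/-- `actKinvFun` as a linear operator. -/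
def actKinv : Distribution q →ₗ[ℂ] Distribution q where
  toFun := actKinvFun q
  map_add' f g := by ext a b; simp [actKinvFun]; ring
  map_smul' c f := by ext a b; simp [actKinvFun]; ring

/-- The action of `E`. -/
def actEFun (f : Distribution q) : Distribution q
  | 0, b => (sq q ^ 3)⁻¹ *
      ((1 - ((qc q ^ 2)⁻¹) ^ (b + 1)) / (1 - (qc q ^ 2)⁻¹)) * f 0 (b + 1)
  | a + 1, b => - sq q * ((1 - (qc q ^ 2) ^ a) / (1 - qc q ^ 2)) * f a b +
      (qc q ^ 2) ^ (a + 1) * (sq q ^ 3)⁻¹ *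
        ((1 - ((qc q ^ 2)⁻¹) ^ (b + 1)) / (1 - (qc q ^ 2)⁻¹)) * f (a + 1) (b + 1)

/-- `actEFun` as a linear operator. -/
def actE : Distribution q →ₗ[ℂ] Distribution q where
  toFun := actEFun q
  map_add' f g := by ext (_ | a) b <;> simp [actEFun] <;> ring
  map_smul' c f := by ext (_ | a) b <;> simp [actEFun] <;> ring

/-- The action of `F`. -/
def actFFun (f : Distribution q) : Distribution q
  | a, 0 => sq q *
      ((1 - ((qc q ^ 2)⁻¹) ^ (a + 1)) / (1 - (qc q ^ 2)⁻¹)) * f (a + 1) 0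
  | a, b + 1 => sq q * ((1 - ((qc q ^ 2)⁻¹) ^ (a + 1)) / (1 - (qc q ^ 2)⁻¹)) *
        (qc q ^ 2) ^ (b + 1) * f (a + 1) (b + 1) -
      sq q ^ 5 * ((1 - (qc q ^ 2) ^ b) / (1 - qc q ^ 2)) * f a b

/-- `actFFun` as a linear operator. -/
def actF : Distribution q →ₗ[ℂ] Distribution q where
  toFun := actFFun q
  map_add' f g := by ext a (_ | b) <;> simp [actFFun] <;> ring
  map_smul' c f := by ext a (_ | b) <;> simp [actFFun] <;> ring

theorem qc_sq : qc q ^ 2 = sq q ^ 4 := by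
  rw [qc_eq, ← pow_mul]

theorem one_sub_sq_ne : 1 - sq q ^ 4 ≠ 0 := by
  rw [← qc_sq]
  exact one_sub_ne q

theorem one_sub_inv : 1 - (sq q ^ 4)⁻¹ = - (1 - sq q ^ 4) / sq q ^ 4 := by
  have := sq_ne q
  field_simp
  ring

/-! The commutation relation of the polynomial algebra and the covariance of the actions of
the generators with respect to the multiplications by `z` and `zstar`. -/

theorem leftZstar_leftZ (f : Distribution q) :
    leftZstar q (leftZ q f) = qc q ^ 2 • leftZ q (leftZstar q f) + (1 - qc q ^ 2) • f := by
  ext (_ | a) (_ | b) <;> simp [leftZ, leftZstar, leftZFun, leftZstarFun] <;> ring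

theorem act_one :
    actK q (one q) = one q ∧ actKinv q (one q) = one q ∧
      actE q (one q) = 0 ∧ actF q (one q) = 0 := by
  refine ⟨?_, ?_, ?_, ?_⟩ <;> ext (_ | _ | a) (_ | _ | b) <;>
    simp [actK, actKinv, actE, actF, actKFun, actKinvFun, actEFun, actFFun, one]

theorem actK_leftZ (f : Distribution q) :
    actK q (leftZ q f) = qc q ^ 2 • leftZ q (actK q f) := by
  ext (_ | a) b <;> simp [leftZ, leftZFun, actK, actKFun]
  ring

theorem actKinv_leftZ (f : Distribution q) :
    actKinv q (leftZ q f) = (qc q ^ 2)⁻¹ • leftZ q (actKinv q f) := by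
  ext (_ | a) b <;> simp [leftZ, leftZFun, actKinv, actKinvFun]
  ring

theorem actE_leftZ (f : Distribution q) :
    actE q (leftZ q f) =
      (-sq q) • leftZ q (leftZ q f) + qc q ^ 2 • leftZ q (actE q f) := by
  have h := one_sub_sq_ne q
  have h1 := sq_ne q
  ext (_ | _ | a) b <;>
    simp only [leftZ, leftZFun, actE, actEFun, inv_pow, qc_sq, one_sub_inv, LinearMap.coe_mk,
      AddHom.coe_mk, Distribution.add_coeff, Distribution.smul_coeff, pow_succ (sq q ^ 4),
      pow_zero, zero_add] <;> field_simp <;> ring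

theorem actF_leftZ (f : Distribution q) :
    actF q (leftZ q f) = sq q • actKinv q f + leftZ q (actF q f) := by
  have h := one_sub_sq_ne q
  have h1 := sq_ne q
  ext (_ | a) (_ | b) <;>
    simp only [leftZ, leftZFun, actF, actFFun, actKinv, actKinvFun, inv_pow, qc_sq,
      one_sub_inv, LinearMap.coe_mk, AddHom.coe_mk, Distribution.add_coeff,
      Distribution.smul_coeff, pow_succ (sq q ^ 4), pow_zero, zero_add] <;> field_simp <;> ring

theorem actK_leftZstar (f : Distribution q) :
    actK q (leftZstar q f) = (qc q ^ 2)⁻¹ • leftZstar q (actK q f) := by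
  have h1 := sq_ne q
  ext a (_ | b) <;>
    simp only [leftZstar, leftZstarFun, actK, actKFun, inv_pow, qc_sq, LinearMap.coe_mk, AddHom.coe_mk, Distribution.smul_coeff, pow_succ (sq q ^ 4),
      pow_zero] <;> field_simp

theorem actKinv_leftZstar (f : Distribution q) :
    actKinv q (leftZstar q f) = qc q ^ 2 • leftZstar q (actKinv q f) := by
  have h1 := sq_ne q
  ext a (_ | b) <;>
    simp only [leftZstar, leftZstarFun, actKinv, actKinvFun, inv_pow, qc_sq, LinearMap.coe_mk, AddHom.coe_mk, Distribution.smul_coeff, pow_succ (sq q ^ 4),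
      pow_zero] <;> field_simp

theorem actE_leftZstar (f : Distribution q) :
    actE q (leftZstar q f) =
      (sq q ^ 3)⁻¹ • f + (qc q ^ 2)⁻¹ • leftZstar q (actE q f) := by
  have h := one_sub_sq_ne q
  have h1 := sq_ne q
  ext (_ | a) (_ | b) <;>
    simp only [leftZstar, leftZstarFun, actE, actEFun, inv_pow, qc_sq, one_sub_inv,
      LinearMap.coe_mk, AddHom.coe_mk, Distribution.add_coeff, Distribution.smul_coeff,
      pow_succ (sq q ^ 4), pow_zero, zero_add] <;> field_simp <;> ring

theorem actF_leftZstar (f : Distribution q) :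
    actF q (leftZstar q f) =
      (-sq q ^ 5) • leftZstar q (leftZstar q (actKinv q f)) + leftZstar q (actF q f) := by
  have h := one_sub_sq_ne q
  have h1 := sq_ne q
  ext a (_ | _ | b) <;>
    simp only [leftZstar, leftZstarFun, actF, actFFun, actKinv, actKinvFun, inv_pow,
      qc_sq, one_sub_inv, LinearMap.coe_mk, AddHom.coe_mk, Distribution.add_coeff,
      Distribution.smul_coeff, pow_succ (sq q ^ 4), pow_zero, zero_add] <;> field_simp <;> ring

theorem actK_rightZ (f : Distribution q) :
    actK q (rightZ q f) = qc q ^ 2 • rightZ q (actK q f) := by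
  have h1 := sq_ne q
  ext (_ | a) b <;>
    simp only [rightZ, rightZFun, actK, actKFun, inv_pow, qc_sq, LinearMap.coe_mk, AddHom.coe_mk, Distribution.smul_coeff, pow_succ (sq q ^ 4),
      pow_zero] <;> field_simp

theorem actKinv_rightZ (f : Distribution q) :
    actKinv q (rightZ q f) = (qc q ^ 2)⁻¹ • rightZ q (actKinv q f) := by
  have h1 := sq_ne q
  ext (_ | a) b <;>
    simp only [rightZ, rightZFun, actKinv, actKinvFun, inv_pow, qc_sq, LinearMap.coe_mk, AddHom.coe_mk, Distribution.smul_coeff, pow_succ (sq q ^ 4),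
      pow_zero] <;> field_simp

theorem actE_rightZ (f : Distribution q) :
    actE q (rightZ q f) =
      rightZ q (actE q f) - sq q • rightZ q (rightZ q (actK q f)) := by
  have h := one_sub_sq_ne q
  have h1 := sq_ne q
  ext (_ | _ | a) b <;>
    simp only [rightZ, rightZFun, actE, actEFun, actK, actKFun, inv_pow, qc_sq,
      one_sub_inv, LinearMap.coe_mk, AddHom.coe_mk, Distribution.sub_coeff,
      Distribution.smul_coeff, pow_succ (sq q ^ 4), pow_zero, zero_add] <;> field_simp <;> ring

theorem actF_rightZ (f : Distribution q) :
    actF q (rightZ q f) = (qc q ^ 2)⁻¹ • rightZ q (actF q f) + sq q • f := by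
  have h := one_sub_sq_ne q
  have h1 := sq_ne q
  ext (_ | a) (_ | b) <;>
    simp only [rightZ, rightZFun, actF, actFFun, inv_pow, qc_sq, one_sub_inv,
      LinearMap.coe_mk, AddHom.coe_mk, Distribution.add_coeff, Distribution.smul_coeff,
      pow_succ (sq q ^ 4), pow_zero, zero_add] <;> field_simp <;> ring

/-- The operators by which the generators of `U_q sl₂` act. -/
def actGen : UqGen → Module.End ℂ (Distribution q)
  | E => actE q
  | F => actF q
  | K => actK q
  | Kinv => actKinv q

theorem act_rel ⦃x y : FreeAlgebra ℂ UqGen⦄ (h : UqRel q x y) :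
    FreeAlgebra.lift ℂ (actGen q) x = FreeAlgebra.lift ℂ (actGen q) y := by
  have hq : ((q : ℝ) : ℂ) = qc q := rfl
  have h0 := one_sub_sq_ne q
  have h1 := sq_ne q
  have h2 := qc_ne q
  have h3 : qc q - (qc q)⁻¹ = - (1 - sq q ^ 4) / sq q ^ 2 := by
    rw [qc_eq]
    field_simp
    ring
  cases h <;>
    simp only [map_mul, map_sub, map_smul, map_one, FreeAlgebra.lift_ι_apply, actGen, hq] <;>
    refine LinearMap.ext fun f => ?_ <;>
    simp only [Module.End.mul_apply, LinearMap.sub_apply, LinearMap.smul_apply,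
      Module.End.one_apply]
  case K_Kinv =>
    ext a b
    simp only [actK, actKFun, actKinv, actKinvFun, inv_pow, LinearMap.coe_mk, AddHom.coe_mk]
    field_simp
  case Kinv_K =>
    ext a b
    simp only [actK, actKFun, actKinv, actKinvFun, inv_pow, LinearMap.coe_mk, AddHom.coe_mk]
    field_simp
  case E_F =>
    rw [h3]
    ext (_ | a) (_ | b) <;>
      simp only [actK, actKFun, actKinv, actKinvFun, actE, actEFun, actF, actFFun, inv_pow,
      qc_sq, one_sub_inv, LinearMap.coe_mk, AddHom.coe_mk, Distribution.sub_coeff,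
      Distribution.smul_coeff, pow_succ (sq q ^ 4), pow_zero, zero_add] <;> field_simp <;> ring
  all_goals
    ext (_ | a) (_ | b) <;>
      simp only [actK, actKFun, actKinv, actKinvFun, actE, actEFun, actF, actFFun, inv_pow,
      qc_sq, one_sub_inv, LinearMap.coe_mk, AddHom.coe_mk, Distribution.smul_coeff,
      pow_succ (sq q ^ 4), pow_zero, zero_add] <;> field_simp

/-- The representation of `U_q sl₂` in the space of distributions. -/
def action : Uq q →ₐ[ℂ] Module.End ℂ (Distribution q) :=
  RingQuot.liftAlgHom ℂ ⟨FreeAlgebra.lift ℂ (actGen q), act_rel q⟩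

theorem action_gen (g : UqGen) : action q (Uq.gen q g) = actGen q g := by
  simp [action, Uq.gen]

instance : Module (Uq q) (Distribution q) :=
  Module.compHom (Distribution q) (action q).toRingHom

theorem smul_def (a : Uq q) (f : Distribution q) : a • f = action q a f := rfl

instance : IsScalarTower ℂ (Uq q) (Distribution q) where
  smul_assoc c a f := by
    rw [smul_def, smul_def, map_smul, LinearMap.smul_apply]

/-! ## Finite functions in the quantum disc -/

/-- A distribution `f` is finite if `zstar ^ N * f = f * z ^ N = 0` for some `N`. -/
def IsFinite (f : Distribution q) : Prop :=
  ∃ N : ℕ, (leftZstar q ^ N) f = 0 ∧ (rightZ q ^ N) f = 0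

variable {q}

theorem pow_apply_mono {T : Module.End ℂ (Distribution q)} {M N : ℕ} (h : M ≤ N)
    {f : Distribution q} (hf : (T ^ M) f = 0) : (T ^ N) f = 0 := by
  obtain ⟨k, rfl⟩ := Nat.exists_eq_add_of_le h
  rw [add_comm, pow_add, Module.End.mul_apply, hf, map_zero]

theorem IsFinite.add {f g : Distribution q} (hf : IsFinite q f) (hg : IsFinite q g) :
    IsFinite q (f + g) := by
  obtain ⟨M, h1, h2⟩ := hf
  obtain ⟨N, h3, h4⟩ := hg
  refine ⟨max M N, ?_, ?_⟩ <;> rw [map_add]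
  · rw [pow_apply_mono (le_max_left M N) h1, pow_apply_mono (le_max_right M N) h3, add_zero]
  · rw [pow_apply_mono (le_max_left M N) h2, pow_apply_mono (le_max_right M N) h4, add_zero]

theorem IsFinite.smul (c : ℂ) {f : Distribution q} (hf : IsFinite q f) :
    IsFinite q (c • f) := by
  obtain ⟨M, h1, h2⟩ := hf
  exact ⟨M, by rw [map_smul, h1, smul_zero], by rw [map_smul, h2, smul_zero]⟩

theorem pow_semicomm {T S : Module.End ℂ (Distribution q)} {c : ℂ}
    (h : ∀ f, T (S f) = c • S (T f)) (N : ℕ) {f : Distribution q} (hf : (T ^ N) f = 0) :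
    (T ^ N) (S f) = 0 := by
  induction N generalizing f with
  | zero => simp_all
  | succ N ih =>
    rw [pow_succ, Module.End.mul_apply] at hf ⊢
    rw [h, map_smul, ih hf, smul_zero]

theorem pow_twisted {T S : Module.End ℂ (Distribution q)} {c : ℂ}
    {R : Distribution q → Distribution q}
    (hR : ∀ N f, (T ^ N) f = 0 → (T ^ N) (R f) = 0)
    (h : ∀ f, T (S f) = c • S (T f) + R f) (N : ℕ) {f : Distribution q}
    (hf : (T ^ N) f = 0) : (T ^ (N + 1)) (S f) = 0 := by
  induction N generalizing f with
  | zero => simp_all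
  | succ N ih =>
    have hf' := hf
    rw [pow_succ, Module.End.mul_apply] at hf'
    rw [pow_succ, Module.End.mul_apply, h, map_add, map_smul, ih hf', smul_zero, zero_add]
    exact hR _ _ hf

theorem pow_comm_apply {T : Module.End ℂ (Distribution q)} {N : ℕ} {f : Distribution q}
    (hf : (T ^ N) f = 0) : (T ^ N) (T f) = 0 := by
  rw [← Module.End.mul_apply, ← pow_succ, pow_succ', Module.End.mul_apply, hf, map_zero]

theorem leftZstar_actKinv (f : Distribution q) :
    leftZstar q (actKinv q f) = (qc q ^ 2)⁻¹ • actKinv q (leftZstar q f) := by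
  rw [actKinv_leftZstar, smul_smul, inv_mul_cancel₀ (pow_ne_zero 2 (qc_ne q)), one_smul]

theorem leftZstar_actK (f : Distribution q) :
    leftZstar q (actK q f) = qc q ^ 2 • actK q (leftZstar q f) := by
  rw [actK_leftZstar, smul_smul, mul_inv_cancel₀ (pow_ne_zero 2 (qc_ne q)), one_smul]

theorem rightZ_actK (f : Distribution q) :
    rightZ q (actK q f) = (qc q ^ 2)⁻¹ • actK q (rightZ q f) := by
  rw [actK_rightZ, smul_smul, inv_mul_cancel₀ (pow_ne_zero 2 (qc_ne q)), one_smul]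

theorem rightZ_actKinv (f : Distribution q) :
    rightZ q (actKinv q f) = qc q ^ 2 • actKinv q (rightZ q f) := by
  rw [actKinv_rightZ, smul_smul, mul_inv_cancel₀ (pow_ne_zero 2 (qc_ne q)), one_smul]

/-- The finite functions are stable under the action of the generators. -/
theorem IsFinite.actGen (g : UqGen) {f : Distribution q} (hf : IsFinite q f) :
    IsFinite q (QuantumDisc.actGen q g f) := by
  obtain ⟨N, h1, h2⟩ := hf
  have hq : qc q ^ 2 ≠ 0 := pow_ne_zero 2 (qc_ne q)
  cases g
  case E =>
    refine ⟨N + 1, pow_twisted (c := qc q ^ 2) (R := fun f => - (qc q ^ 2 * (sq q ^ 3)⁻¹) • f)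
        (fun M g hg => by rw [map_smul, hg, smul_zero]) (fun g => ?_) N h1,
      pow_twisted (c := 1) (R := fun f => sq q • rightZ q (rightZ q (actK q f)))
        (fun M g hg => ?_) (fun g => ?_) N h2⟩
    · change leftZstar q (actE q g) = qc q ^ 2 • actE q (leftZstar q g) + _
      rw [actE_leftZstar, smul_add, smul_smul, smul_smul, mul_inv_cancel₀ hq]
      module
    · rw [map_smul, pow_comm_apply (pow_comm_apply (pow_semicomm rightZ_actK M hg)), smul_zero]
    · change rightZ q (actE q g) = (1 : ℂ) • actE q (rightZ q g) + _
      rw [actE_rightZ]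
      module
  case F =>
    refine ⟨N + 1, pow_twisted (c := 1)
        (R := fun f => sq q ^ 5 • leftZstar q (leftZstar q (actKinv q f)))
        (fun M g hg => ?_) (fun g => ?_) N h1,
      pow_twisted (c := qc q ^ 2) (R := fun f => - (qc q ^ 2 * sq q) • f)
        (fun M g hg => by rw [map_smul, hg, smul_zero]) (fun g => ?_) N h2⟩
    · rw [map_smul, pow_comm_apply (pow_comm_apply (pow_semicomm leftZstar_actKinv M hg)),
        smul_zero]
    · change leftZstar q (actF q g) = (1 : ℂ) • actF q (leftZstar q g) + _
      rw [actF_leftZstar]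
      module
    · change rightZ q (actF q g) = qc q ^ 2 • actF q (rightZ q g) + _
      rw [actF_rightZ, smul_add, smul_smul, smul_smul, mul_inv_cancel₀ hq]
      module
  case K =>
    exact ⟨N, pow_semicomm leftZstar_actK N h1, pow_semicomm rightZ_actK N h2⟩
  case Kinv =>
    exact ⟨N, pow_semicomm leftZstar_actKinv N h1, pow_semicomm rightZ_actKinv N h2⟩

theorem IsFinite.uq_smul (a : Uq q) {f : Distribution q} (hf : IsFinite q f) :
    IsFinite q (a • f) := by
  obtain ⟨x, rfl⟩ := RingQuot.mkAlgHom_surjective ℂ (UqRel q) a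
  rw [smul_def, action, RingQuot.liftAlgHom_mkAlgHom_apply]
  induction x using FreeAlgebra.induction generalizing f with
  | grade0 r => simpa [Algebra.algebraMap_eq_smul_one] using hf.smul r
  | grade1 g => simpa using hf.actGen g
  | mul x y hx hy => simpa using hx (hy hf)
  | add x y hx hy => simpa using (hx hf).add (hy hf)

variable (q)

/-- The `U_q sl₂`-module `D(U)_q` of finite functions in the quantum disc. -/
def finiteFunctions : Submodule (Uq q) (Distribution q) where
  carrier := {f | IsFinite q f}
  add_mem' := IsFinite.add
  zero_mem' := ⟨0, by simp, by simp⟩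
  smul_mem' a _ hf := IsFinite.uq_smul a hf

/-- The distribution `f₀ = ∑ c k • z ^ k * zstar ^ k` with
`c k = (-1) ^ k * q ^ (k * (k - 1)) / ∏ i ∈ {1, …, k}, (1 - q ^ (2 * i))`. Up to a scalar multiple,
it is the only distribution with `zstar * f₀ = f₀ * z = 0`; it is normalized by `c 0 = 1`,
that is by `f₀ * f₀ = f₀`. In the representation of the finite functions by finite matrices it is
the matrix unit with the index `(0, 0)`. -/
def vacuum : Distribution q := fun a b =>
  if a = b then
    (-1) ^ a * qc q ^ (a * (a - 1)) / ∏ i ∈ Finset.range a, (1 - (qc q ^ 2) ^ (i + 1))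
  else 0

theorem one_sub_pow_ne (n : ℕ) : 1 - (qc q ^ 2) ^ (n + 1) ≠ 0 := by
  have h1 : ((q : ℝ) ^ 2) ^ (n + 1) < 1 :=
    pow_lt_one₀ (by positivity) (by nlinarith [q.2.1, q.2.2]) (by omega)
  have h : (1 : ℝ) - ((q : ℝ) ^ 2) ^ (n + 1) ≠ 0 := by linarith
  rw [qc]
  exact_mod_cast h

theorem vacuum_succ (a : ℕ) :
    (1 - (qc q ^ 2) ^ (a + 1)) * vacuum q (a + 1) (a + 1) = - (qc q ^ 2) ^ a * vacuum q a a := by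
  have h := one_sub_pow_ne q a
  have hp : ∏ i ∈ Finset.range a, (1 - (qc q ^ 2) ^ (i + 1)) ≠ 0 :=
    Finset.prod_ne_zero_iff.2 fun i _ => one_sub_pow_ne q i
  have he : (a + 1) * (a + 1 - 1) = a * (a - 1) + 2 * a := by
    cases a with
    | zero => rfl
    | succ n => simp; ring
  simp only [vacuum, if_true, Finset.prod_range_succ, he, pow_add _ (a * (a - 1)), pow_mul (qc q) 2]
  field_simp
  ring

theorem leftZstar_vacuum : leftZstar q (vacuum q) = 0 := by
  ext a (_ | b)
  · simp [leftZstar, leftZstarFun, vacuum]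
  · rcases eq_or_ne a b with rfl | hab
    · simp only [leftZstar, leftZstarFun, LinearMap.coe_mk, AddHom.coe_mk, vacuum_succ,
        Distribution.zero_coeff]
      ring
    · simp [leftZstar, leftZstarFun, vacuum, hab]

theorem rightZ_vacuum : rightZ q (vacuum q) = 0 := by
  ext (_ | a) b
  · simp [rightZ, rightZFun, vacuum]
  · rcases eq_or_ne a b with rfl | hab
    · simp only [rightZ, rightZFun, LinearMap.coe_mk, AddHom.coe_mk, vacuum_succ,
        Distribution.zero_coeff]
      ring
    · simp [rightZ, rightZFun, vacuum, hab]

/-- The finite function `f₀`. -/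
def f₀ : finiteFunctions q :=
  ⟨vacuum q, 1, by simpa using leftZstar_vacuum q, by simpa using rightZ_vacuum q⟩

end QuantumDisc

end

noncomputable section

namespace QuantumDisc

/-! The elements `z^m f₀ zstar^n` behave like matrix units. Left multiplication by `zstar` lowers
`m` and right multiplication by `z` lowers `n`, with weights `1 - q^(2i)`, `i ≥ 1`, that never
vanish. The common kernel of the two lowering operators is the line through `f₀`, so induction on
the nilpotency exponents shows that every finite function is a linear combination of matrix units
(`mem_unitSpan`).

Covariance then gives the action: `E` raises `m` when `n = 0`, and `F` raises `n` up to a multiple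
of the unit with `m` lowered by one (no such term when `m = 0`). The raising coefficients are
nonzero, so all matrix units lie in the submodule generated by `f₀` (`unit_mem_of_vacuum_mem`). An
invariant integral is therefore determined by its value at `f₀`. -/

variable (q : Set.Ioo (0 : ℝ) 1)

/-! ### Right multiplication by `zstar` and the commutation relations -/

/-- The right multiplication by `zstar`. -/
def rightZstarFun (f : Distribution q) : Distribution q
  | _, 0 => 0
  | a, b + 1 => f a b

/-- `rightZstarFun` as a linear operator. -/
def rightZstar : Distribution q →ₗ[ℂ] Distribution q where
  toFun := rightZstarFun q
  map_add' f g := by ext a (_ | b) <;> simp [rightZstarFun]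
  map_smul' c f := by ext a (_ | b) <;> simp [rightZstarFun]

theorem rightZ_rightZstar (f : Distribution q) :
    rightZ q (rightZstar q f) =
      qc q ^ 2 • rightZstar q (rightZ q f) + (1 - qc q ^ 2) • f := by
  ext (_ | a) (_ | b) <;> simp [rightZ, rightZstar, rightZFun, rightZstarFun] <;> ring

/-- This and the three lemmas below express the associativity of the bimodule structure. -/
theorem leftZstar_rightZstar (f : Distribution q) :
    leftZstar q (rightZstar q f) = rightZstar q (leftZstar q f) := by
  ext (_ | a) (_ | _ | b) <;>
    simp [leftZstar, rightZstar, leftZstarFun, rightZstarFun]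

theorem leftZ_rightZstar (f : Distribution q) :
    leftZ q (rightZstar q f) = rightZstar q (leftZ q f) := by
  ext (_ | a) (_ | b) <;> simp [leftZ, rightZstar, leftZFun, rightZstarFun]

theorem leftZ_rightZ (f : Distribution q) :
    leftZ q (rightZ q f) = rightZ q (leftZ q f) := by
  ext (_ | _ | a) b <;> simp [leftZ, rightZ, leftZFun, rightZFun]

theorem leftZstar_rightZ (f : Distribution q) :
    leftZstar q (rightZ q f) = rightZ q (leftZstar q f) := by
  ext (_ | a) (_ | b) <;> simp [leftZstar, rightZ, leftZstarFun, rightZFun] <;> ring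

theorem actKinv_rightZstar (f : Distribution q) :
    actKinv q (rightZstar q f) = qc q ^ 2 • rightZstar q (actKinv q f) := by
  ext a (_ | b) <;> simp [rightZstar, rightZstarFun, actKinv, actKinvFun]
  ring

/-- Covariance `F (f * zstar) = F f * K⁻¹ zstar + f * F zstar`, which propagates the action of `F`
along row zero. -/
theorem actF_rightZstar (f : Distribution q) :
    actF q (rightZstar q f) =
      qc q ^ 2 • rightZstar q (actF q f) + (-sq q ^ 5) • rightZstar q (rightZstar q f) := by
  have h := one_sub_sq_ne q
  have h1 := sq_ne q
  ext a (_ | _ | b) <;>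
    simp only [rightZstar, rightZstarFun, actF, actFFun, inv_pow,
      qc_sq, one_sub_inv, LinearMap.coe_mk, AddHom.coe_mk, Distribution.add_coeff,
      Distribution.smul_coeff, pow_succ (sq q ^ 4), pow_zero, zero_add] <;> field_simp <;> ring

/-! ### The common kernel of the lowering operators -/

/-- A distribution annihilated by `zstar` on the left is determined by its coefficients at the
powers of `zstar`. -/
theorem eq_zero_of_leftZstar_eq_zero {f : Distribution q} (hf : leftZstar q f = 0)
    (h0 : ∀ b, f 0 b = 0) : f = 0 := by
  ext a b
  induction a generalizing b with
  | zero => exact h0 b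
  | succ a ih =>
    -- The coefficient of `zstar * f` in row `a` expresses row `a + 1` through row `a`, with the
    -- invertible factor `1 - q^(2(a+1))`.
    refine (mul_eq_zero.1 ?_).resolve_left (one_sub_pow_ne q a)
    cases b with
    | zero => exact congrFun (congrFun hf a) 0
    | succ b =>
      have h := congrFun (congrFun hf a) (b + 1)
      change (qc q ^ 2) ^ a * f a b + (1 - (qc q ^ 2) ^ (a + 1)) * f (a + 1) (b + 1) = 0 at h
      rw [ih b] at h
      simpa using h

/-- The distributions with `zstar * f = f * z = 0` are the multiples of the vacuum. -/
theorem eq_smul_vacuum {f : Distribution q} (hl : leftZstar q f = 0) (hr : rightZ q f = 0) :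
    f = f 0 0 • vacuum q := by
  refine sub_eq_zero.1 (eq_zero_of_leftZstar_eq_zero q ?_ fun b => ?_)
  · rw [map_sub, map_smul, hl, leftZstar_vacuum, smul_zero, sub_zero]
  · cases b with
    | zero => simp [vacuum]
    | succ b =>
      have h : f 0 (b + 1) = 0 :=
        (mul_eq_zero.1 (congrFun (congrFun hr 0) b)).resolve_left (one_sub_pow_ne q b)
      simp [vacuum, h]

/-! ### Matrix units and their lowering operators -/

/-- The matrix unit `z ^ m * f₀ * zstar ^ n`, up to a scalar multiple. -/
def unit : ℕ → ℕ → Distribution q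
  | 0, 0 => vacuum q
  | 0, n + 1 => rightZstar q (unit 0 n)
  | m + 1, n => leftZ q (unit m n)

theorem unit_zero_succ (n : ℕ) : unit q 0 (n + 1) = rightZstar q (unit q 0 n) := by
  rw [unit]

theorem unit_succ (m n : ℕ) : unit q (m + 1) n = leftZ q (unit q m n) := by
  rw [unit]

/-- Left and right multiplications commute, so the order in which the recursion builds the indices
is immaterial. -/
theorem rightZstar_unit (m n : ℕ) : rightZstar q (unit q m n) = unit q m (n + 1) := by
  induction m with
  | zero => rw [unit_zero_succ]
  | succ m ih => rw [unit_succ, unit_succ, ← ih, leftZ_rightZstar]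

theorem leftZstar_unit_zero (n : ℕ) : leftZstar q (unit q 0 n) = 0 := by
  induction n with
  | zero => rw [unit, leftZstar_vacuum]
  | succ n ih => rw [unit_zero_succ, leftZstar_rightZstar, ih, map_zero]

/-- Moving `zstar` past one more `z` turns the weight `w` into `q^2 w + 1 - q^2`; starting from `0`,
this iterates to `1 - q^(2(m+1))`. -/
theorem leftZstar_unit_succ (m n : ℕ) :
    leftZstar q (unit q (m + 1) n) = (1 - (qc q ^ 2) ^ (m + 1)) • unit q m n := by
  induction m with
  | zero => rw [unit_succ, leftZstar_leftZ, leftZstar_unit_zero]; simp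
  | succ m ih =>
    rw [unit_succ, leftZstar_leftZ, ih, map_smul, ← unit_succ]
    module

theorem rightZ_unit_zero (m : ℕ) : rightZ q (unit q m 0) = 0 := by
  induction m with
  | zero => rw [unit, rightZ_vacuum]
  | succ m ih => rw [unit_succ, ← leftZ_rightZ, ih, map_zero]

theorem rightZ_unit_succ (m n : ℕ) :
    rightZ q (unit q m (n + 1)) = (1 - (qc q ^ 2) ^ (n + 1)) • unit q m n := by
  induction n with
  | zero => rw [← rightZstar_unit, rightZ_rightZstar, rightZ_unit_zero]; simp
  | succ n ih =>
    rw [← rightZstar_unit, rightZ_rightZstar, ih, map_smul, rightZstar_unit]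
    module

theorem leftZstar_pow_unit (m n : ℕ) : (leftZstar q ^ (m + 1)) (unit q m n) = 0 := by
  induction m with
  | zero => simpa using leftZstar_unit_zero q n
  | succ m ih => rw [pow_succ, Module.End.mul_apply, leftZstar_unit_succ, map_smul, ih, smul_zero]

theorem rightZ_pow_unit (m n : ℕ) : (rightZ q ^ (n + 1)) (unit q m n) = 0 := by
  induction n with
  | zero => simpa using rightZ_unit_zero q m
  | succ n ih => rw [pow_succ, Module.End.mul_apply, rightZ_unit_succ, map_smul, ih, smul_zero]

theorem isFinite_unit (m n : ℕ) : IsFinite q (unit q m n) :=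
  ⟨m + 1 + (n + 1), pow_apply_mono (by omega) (leftZstar_pow_unit q m n),
    pow_apply_mono (by omega) (rightZ_pow_unit q m n)⟩

/-! ### Finite functions as combinations of matrix units -/

/-- The span of the matrix units of the zeroth row. -/
def rowSpan : Submodule ℂ (Distribution q) :=
  Submodule.span ℂ (Set.range (unit q 0))

/-- The span of all the matrix units. -/
def unitSpan : Submodule ℂ (Distribution q) :=
  Submodule.span ℂ (Set.range fun p : ℕ × ℕ => unit q p.1 p.2)

theorem unit_mem_unitSpan (m n : ℕ) : unit q m n ∈ unitSpan q :=
  Submodule.subset_span ⟨(m, n), rfl⟩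

theorem rowSpan_le_unitSpan : rowSpan q ≤ unitSpan q := by
  refine Submodule.span_le.2 ?_
  rintro _ ⟨n, rfl⟩
  exact unit_mem_unitSpan q 0 n

theorem leftZstar_of_mem_rowSpan {f : Distribution q} (hf : f ∈ rowSpan q) :
    leftZstar q f = 0 := by
  have h : rowSpan q ≤ LinearMap.ker (leftZstar q) := by
    refine Submodule.span_le.2 ?_
    rintro _ ⟨n, rfl⟩
    exact leftZstar_unit_zero q n
  exact h hf

theorem isFinite_of_mem_unitSpan {f : Distribution q} (hf : f ∈ unitSpan q) :
    IsFinite q f := by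
  induction hf using Submodule.span_induction with
  | mem x hx => obtain ⟨p, rfl⟩ := hx; exact isFinite_unit q p.1 p.2
  | zero => exact ⟨0, by simp, by simp⟩
  | add x y _ _ hx hy => exact hx.add hy
  | smul c x _ hx => exact hx.smul c

/-- The lowering weights are invertible, so preimages can be chosen inside the span; this is what
the induction on the nilpotency exponent needs. -/
theorem rowSpan_le_map_rightZ : rowSpan q ≤ (rowSpan q).map (rightZ q) := by
  refine Submodule.span_le.2 ?_
  rintro _ ⟨n, rfl⟩
  refine ⟨(1 - (qc q ^ 2) ^ (n + 1))⁻¹ • unit q 0 (n + 1),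
    Submodule.smul_mem _ _ (Submodule.subset_span ⟨n + 1, rfl⟩), ?_⟩
  rw [map_smul, rightZ_unit_succ, inv_smul_smul₀ (one_sub_pow_ne q n)]

theorem unitSpan_le_map_leftZstar : unitSpan q ≤ (unitSpan q).map (leftZstar q) := by
  refine Submodule.span_le.2 ?_
  rintro _ ⟨⟨m, n⟩, rfl⟩
  refine ⟨(1 - (qc q ^ 2) ^ (m + 1))⁻¹ • unit q (m + 1) n,
    Submodule.smul_mem _ _ (unit_mem_unitSpan q (m + 1) n), ?_⟩
  rw [map_smul, leftZstar_unit_succ, inv_smul_smul₀ (one_sub_pow_ne q m)]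

/-- By induction `f * z` lies in the span; subtracting a preimage `g` from the span leaves an
element killed on both sides, a multiple of `f₀`. -/
theorem mem_rowSpan {N : ℕ} {f : Distribution q} (hl : leftZstar q f = 0)
    (hr : (rightZ q ^ N) f = 0) : f ∈ rowSpan q := by
  induction N generalizing f with
  | zero => simp_all
  | succ N ih =>
    obtain ⟨g, hg, hgf⟩ := rowSpan_le_map_rightZ q
      (ih (f := rightZ q f) (by rw [leftZstar_rightZ, hl, map_zero])
        (by rwa [pow_succ, Module.End.mul_apply] at hr))
    rw [← sub_add_cancel f g,
      eq_smul_vacuum q (f := f - g) (by rw [map_sub, hl, leftZstar_of_mem_rowSpan q hg, sub_zero])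
        (by rw [map_sub, hgf, sub_self])]
    exact add_mem (Submodule.smul_mem _ _ (Submodule.subset_span ⟨0, by rw [unit]⟩)) hg

/-- The finite functions are the linear combinations of the matrix units. -/
theorem mem_unitSpan {M N : ℕ} {f : Distribution q} (hl : (leftZstar q ^ M) f = 0)
    (hr : (rightZ q ^ N) f = 0) : f ∈ unitSpan q := by
  induction M generalizing f N with
  | zero => simp_all
  | succ M ih =>
    have hc : Commute (rightZ q ^ N) (leftZstar q) :=
      Commute.pow_left (LinearMap.ext fun f => (leftZstar_rightZ q f).symm) N
    obtain ⟨g, hg, hgf⟩ := unitSpan_le_map_leftZstar q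
      (ih (N := N) (f := leftZstar q f) (by rwa [pow_succ, Module.End.mul_apply] at hl)
        (by rw [← Module.End.mul_apply, hc.eq, Module.End.mul_apply, hr, map_zero]))
    -- The preimage `g` has its own right exponent. The difference `f - g` is killed by `zstar` on
    -- the left and by a larger power of `z` on the right, hence belongs to row zero.
    obtain ⟨N', -, hN'⟩ := isFinite_of_mem_unitSpan q hg
    rw [← sub_add_cancel f g]
    refine add_mem (rowSpan_le_unitSpan q (mem_rowSpan q (N := max N N') ?_ ?_)) hg
    · rw [map_sub, hgf, sub_self]
    · rw [map_sub, pow_apply_mono (le_max_left N N') hr, pow_apply_mono (le_max_right N N') hN',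
        sub_zero]

/-! ### The action on the matrix units -/

/-- Applying `E` to `zstar * f₀ = 0` gives `zstar * E f₀ = -q^(1/2) f₀`. This and the vanishing
zeroth row of coefficients determine `E f₀`. -/
theorem actE_vacuum :
    actE q (vacuum q) = (-sq q / (1 - qc q ^ 2)) • unit q 1 0 := by
  have h := actE_leftZstar q (vacuum q)
  rw [leftZstar_vacuum, map_zero] at h
  have hl : leftZstar q (actE q (vacuum q)) = (-sq q) • vacuum q := by
    have h1 := sq_ne q
    have h3 : leftZstar q (actE q (vacuum q)) =
        (-(qc q ^ 2 * (sq q ^ 3)⁻¹)) • vacuum q := by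
      rw [neg_smul, mul_smul, ← smul_neg, neg_eq_of_add_eq_zero_right h.symm, smul_smul,
        mul_inv_cancel₀ (pow_ne_zero 2 (qc_ne q)), one_smul]
    rw [h3, qc_sq]
    congr 1
    field_simp
  have hu := leftZstar_unit_succ q 0 0
  rw [zero_add, pow_one, unit] at hu
  refine sub_eq_zero.1 (eq_zero_of_leftZstar_eq_zero q ?_ fun b => ?_)
  · rw [map_sub, map_smul, hl, hu, smul_smul, div_mul_cancel₀ _ (one_sub_ne q), sub_self]
  · simp [actE, actEFun, unit, leftZ, leftZFun, vacuum]

/-- The coefficient does not depend on `m`: it is the fixed point of `c = -q^(1/2) + q^2 c`, the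
recursion given by covariance. -/
theorem actE_unit (m : ℕ) :
    actE q (unit q m 0) = (-sq q / (1 - qc q ^ 2)) • unit q (m + 1) 0 := by
  have h2 := one_sub_ne q
  induction m with
  | zero => rw [unit, actE_vacuum]
  | succ m ih =>
    rw [unit_succ q m, actE_leftZ, ih, map_smul, ← unit_succ, ← unit_succ, smul_smul, ← add_smul]
    congr 1
    field_simp
    ring

/-- Applying `F` to `zstar * f₀ = 0` gives `zstar * F f₀ = 0`, so comparing the coefficients at
powers of `zstar` suffices. -/
theorem actF_vacuum :
    actF q (vacuum q) = (-sq q ^ 5 / (1 - qc q ^ 2)) • unit q 0 1 := by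
  have h := actF_leftZstar q (vacuum q)
  rw [leftZstar_vacuum, map_zero, leftZstar_actKinv, leftZstar_vacuum, map_zero, smul_zero,
    map_zero, smul_zero, zero_add] at h
  refine sub_eq_zero.1 (eq_zero_of_leftZstar_eq_zero q ?_ fun b => ?_)
  · rw [map_sub, map_smul, ← h, leftZstar_unit_zero, smul_zero, sub_zero]
  · have h1 := sq_ne q
    have h2 := one_sub_sq_ne q
    have h3 : sq q ^ 4 - 1 ≠ 0 := sub_ne_zero_of_ne (sub_ne_zero.1 h2).symm
    -- Only `b = 1` contributes, through the coefficient `-1 / (1 - q^2)` of `f₀` at `z * zstar`.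
    rcases b with _ | _ | b
    · simp [actF, actFFun, unit, rightZstar, rightZstarFun, vacuum]
    · simp [actF, actFFun, unit, rightZstar, rightZstarFun, vacuum, qc_sq, one_sub_inv]
      field_simp
      ring
    · simp [actF, actFFun, unit, rightZstar, rightZstarFun, vacuum]

theorem actF_unit_zero (n : ℕ) :
    actF q (unit q 0 n) = (-sq q ^ 5 / (1 - qc q ^ 2)) • unit q 0 (n + 1) := by
  have h2 := one_sub_ne q
  induction n with
  | zero => rw [unit, actF_vacuum]
  | succ n ih =>
    rw [unit_zero_succ q n, actF_rightZstar, ih, map_smul, ← unit_zero_succ, ← unit_zero_succ,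
      ← unit_zero_succ, smul_smul, ← add_smul]
    congr 1
    field_simp
    ring

theorem actKinv_unit (m n : ℕ) : ∃ c : ℂ, actKinv q (unit q m n) = c • unit q m n := by
  induction m with
  | zero =>
    induction n with
    | zero =>
      -- `f₀` is supported on the diagonal, where the weights of `K⁻¹` cancel.
      refine ⟨1, ?_⟩
      have h := qc_ne q
      ext a b
      by_cases hab : a = b
      · subst hab
        simp [unit, actKinv, actKinvFun]
        field_simp
      · simp [unit, actKinv, actKinvFun, vacuum, hab]
    | succ n ih =>
      obtain ⟨c, hc⟩ := ih
      exact ⟨qc q ^ 2 * c, by rw [unit_zero_succ, actKinv_rightZstar, hc, map_smul, smul_smul]⟩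
  | succ m ih =>
    obtain ⟨c, hc⟩ := ih
    exact ⟨(qc q ^ 2)⁻¹ * c, by rw [unit_succ, actKinv_leftZ, hc, map_smul, smul_smul]⟩

/-- In `F (z u) = q^(1/2) K⁻¹ u + z F u` the first term stays on the line of `u`, so the leading
coefficient is that of row zero. The value of `c` is irrelevant for generation. -/
theorem actF_unit_succ (m n : ℕ) : ∃ c : ℂ, actF q (unit q (m + 1) n) =
    (-sq q ^ 5 / (1 - qc q ^ 2)) • unit q (m + 1) (n + 1) + c • unit q m n := by
  induction m with
  | zero =>
    obtain ⟨c, hc⟩ := actKinv_unit q 0 n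
    refine ⟨sq q * c, ?_⟩
    rw [unit_succ, actF_leftZ, hc, actF_unit_zero, map_smul, ← unit_succ]
    module
  | succ m ih =>
    obtain ⟨c, hc⟩ := actKinv_unit q (m + 1) n
    obtain ⟨d, hd⟩ := ih
    refine ⟨sq q * c + d, ?_⟩
    rw [unit_succ q (m + 1), actF_leftZ, hc, hd, map_add, map_smul, map_smul, ← unit_succ,
      ← unit_succ]
    module

/-! ### Generation by `f₀` and uniqueness of the integral -/

theorem gen_smul (g : UqGen) (f : Distribution q) : Uq.gen q g • f = actGen q g f := by
  rw [smul_def, action_gen]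

theorem smul_mem_uq (S : Submodule (Uq q) (Distribution q)) (c : ℂ) {f : Distribution q}
    (hf : f ∈ S) : c • f ∈ S := by
  rw [← one_smul (Uq q) f, ← smul_assoc]
  exact S.smul_mem _ hf

theorem unit_mem_of_vacuum_mem {S : Submodule (Uq q) (Distribution q)} (h : vacuum q ∈ S)
    (m n : ℕ) : unit q m n ∈ S := by
  have hE : ∀ f ∈ S, actE q f ∈ S := fun f hf => gen_smul q .E f ▸ S.smul_mem _ hf
  have hF : ∀ f ∈ S, actF q f ∈ S := fun f hf => gen_smul q .F f ▸ S.smul_mem _ hf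
  have hβ : -sq q ^ 5 / (1 - qc q ^ 2) ≠ 0 :=
    div_ne_zero (neg_ne_zero.2 (pow_ne_zero 5 (sq_ne q))) (one_sub_ne q)
  induction n generalizing m with
  | zero =>
    induction m with
    | zero => rwa [unit]
    | succ m ih =>
      have := smul_mem_uq q S (-sq q / (1 - qc q ^ 2))⁻¹ (hE _ ih)
      rwa [actE_unit, inv_smul_smul₀ (div_ne_zero (neg_ne_zero.2 (sq_ne q)) (one_sub_ne q))] at this
  | succ n ih =>
    cases m with
    | zero =>
      have := smul_mem_uq q S (-sq q ^ 5 / (1 - qc q ^ 2))⁻¹ (hF _ (ih 0))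
      rwa [actF_unit_zero, inv_smul_smul₀ hβ] at this
    | succ m =>
      obtain ⟨c, hc⟩ := actF_unit_succ q m n
      -- Induction on the column: the correction term `c • unit q m n` is in the column already
      -- obtained and can be subtracted.
      have := smul_mem_uq q S (-sq q ^ 5 / (1 - qc q ^ 2))⁻¹
        (sub_mem (hF _ (ih (m + 1))) (smul_mem_uq q S c (ih m)))
      rwa [hc, add_sub_cancel_right, inv_smul_smul₀ hβ] at this

theorem span_f₀ : Submodule.span (Uq q) {f₀ q} = ⊤ := by
  refine Submodule.map_injective_of_injective (finiteFunctions q).injective_subtype ?_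
  rw [Submodule.map_subtype_top, Submodule.map_span, Set.image_singleton]
  refine le_antisymm ?_ fun f hf => ?_
  · rw [Submodule.span_singleton_le_iff_mem]
    exact (f₀ q).2
  · obtain ⟨N, h1, h2⟩ := hf
    refine Submodule.span_induction (p := fun x _ => x ∈ _) ?_ (zero_mem _)
      (fun _ _ _ _ => add_mem) (fun c _ _ => smul_mem_uq q _ c) (mem_unitSpan q h1 h2)
    rintro _ ⟨p, rfl⟩
    exact unit_mem_of_vacuum_mem q (Submodule.mem_span_singleton_self _) p.1 p.2

theorem rank_hom_le_one :
    Module.rank ℂ (finiteFunctions q →ₗ[Uq q] TrivialModule q) ≤ 1 := by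
  -- Evaluation at the generator `f₀` embeds the space of invariant integrals into `ℂ`.
  let ev : (finiteFunctions q →ₗ[Uq q] TrivialModule q) →ₗ[ℂ] ℂ :=
    { toFun := fun φ => φ (f₀ q)
      map_add' := fun _ _ => rfl
      map_smul' := fun _ _ => rfl }
  have hev : Function.Injective ev := fun φ ψ h =>
    LinearMap.ext_on (span_f₀ q) (Set.eqOn_singleton.2 h)
  simpa using LinearMap.rank_le_of_injective ev hev

end QuantumDisc

end

theorem corollary3p10 (q : Set.Ioo (0 : ℝ) 1) :
    Submodule.span (QuantumDisc.Uq q) {QuantumDisc.f₀ q} = ⊤ ∧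
      Module.rank ℂ
        (QuantumDisc.finiteFunctions q →ₗ[QuantumDisc.Uq q] QuantumDisc.TrivialModule q) ≤ 1 :=
  ⟨QuantumDisc.span_f₀ q, QuantumDisc.rank_hom_le_one q⟩
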